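/- Let $d\ge 1$, let $S\in \mathrm{GL}_d(\mathbb Z)$ be totally irreducible, i.e. for every $n\ge 1$ the characteristic polynomial of $S^n$ is irreducible over $\mathbb Q$, and let $S$ also denote the induced automorphism of $\mathbb T^d=\mathbb R^d/\mathbb Z^d$. For $\nu\in\mathbb C$ let $E^\nu_S\subseteq\mathbb R^d$ be the space of real vectors lying in the complex span of the eigenvectors of $S$ for $\nu$ and $\bar\nu$, and let $V_S^{0-}=\sum_{|\nu|\le 1}E_S^\nu$ be the weak stable subspace of $S$. Let $W\subseteq\mathbb R^d$ be a one-dimensional linear subspace with $W\not\subseteq V_S^{0-}$, let $w\in W\setminus\{0\}$, and let $x\in\mathbb T^d$. Then for Lebesgue-almost every $\varphi\in[-\tfrac12,\tfrac12]$ the point $y=x+\varphi w\in\mathbb T^d$ equidistributes under $S$, i.e. $$\lim_{N\to\infty}\frac1N\sum_{n=0}^{N-1}f(S^n y)=\int_{\mathbb T^d}f\,dm\qquad\text{for every } f\in C(\mathbb T^d),$$ where $m$ is the normalized Lebesgue measure on $\mathbb T^d$. -/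

import Mathlib

open MeasureTheory Filter Topology

/-- An integer matrix is irreducible if its characteristic polynomial is irreducible over `ℚ`. -/
def IsIrreducibleMatrix {d : ℕ} (S : Matrix (Fin d) (Fin d) ℤ) : Prop :=
  Irreducible (S.charpoly.map (Int.castRingHom ℚ))

/-- An integer matrix is totally irreducible if each of its powers `S ^ n`, `n ≥ 1`, is
irreducible. -/
def IsTotallyIrreducible {d : ℕ} (S : Matrix (Fin d) (Fin d) ℤ) : Prop :=
  ∀ n : ℕ, 1 ≤ n → IsIrreducibleMatrix (S ^ n)

/-- The linear map of `ℂ^d` given by an integer matrix. -/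
noncomputable def complexMap {d : ℕ} (S : Matrix (Fin d) (Fin d) ℤ) :
    Module.End ℂ (Fin d → ℂ) :=
  Matrix.toLin' (S.map (Int.cast : ℤ → ℂ))

/-- The inclusion of `ℝ^d` into `ℂ^d`, as a real linear map. -/
noncomputable def complexify (d : ℕ) : (Fin d → ℝ) →ₗ[ℝ] (Fin d → ℂ) :=
  Complex.ofRealCLM.toLinearMap.compLeft (Fin d)

/-- The real subspace of `ℝ^d` that belongs to the eigenvalue `ν` of `S`: the vectors of `ℝ^d`
that lie in the complex span of the eigenvectors for `ν` and for its complex conjugate. For real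
`ν` this is the real eigenspace. -/
noncomputable def realEigenspace {d : ℕ} (S : Matrix (Fin d) (Fin d) ℤ) (ν : ℂ) :
    Submodule ℝ (Fin d → ℝ) :=
  (((complexMap S).eigenspace ν ⊔
    (complexMap S).eigenspace (starRingEnd ℂ ν)).restrictScalars ℝ).comap (complexify d)

/-- The weak stable subspace: the sum of the spaces `realEigenspace S ν` over all `ν` of absolute
value at most one. (If `ν` is not an eigenvalue, its space is zero.) -/
noncomputable def weakStable {d : ℕ} (S : Matrix (Fin d) (Fin d) ℤ) :
    Submodule ℝ (Fin d → ℝ) :=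
  ⨆ (ν : ℂ) (_ : ‖ν‖ ≤ 1), realEigenspace S ν

/-- The projection `ℝ^d → 𝕋^d = (ℝ/ℤ)^d`. -/
noncomputable def torusProj {d : ℕ} (v : Fin d → ℝ) : UnitAddTorus (Fin d) :=
  fun i => (v i : UnitAddCircle)

/-- The map of `𝕋^d` induced by an integer matrix. -/
noncomputable def toralMap {d : ℕ} (S : Matrix (Fin d) (Fin d) ℤ)
    (x : UnitAddTorus (Fin d)) : UnitAddTorus (Fin d) :=
  fun i => ∑ j, S i j • x j

/-- `Eq(S)`: the set of points whose forward orbit under `S` equidistributes on `𝕋^d` with respect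
to Lebesgue measure. -/
noncomputable def equidistributedPoints {d : ℕ} (S : Matrix (Fin d) (Fin d) ℤ) :
    Set (UnitAddTorus (Fin d)) :=
  {x | ∀ f : C(UnitAddTorus (Fin d), ℂ),
    Tendsto (fun N : ℕ => (1 / (N : ℂ)) * ∑ n ∈ Finset.range N, f ((toralMap S)^[n] x))
      atTop (𝓝 (∫ y, f y))}

/-! By Weyl's criterion, and because there are only countably many characters, it suffices to fix `k
≠ 0` and average e(k·Sⁿx) e(φ aₙ), where aₙ = k·Sⁿw. In eigencoordinates aₙ is an exponential sum
over eigenvalues of `S`. As `w` is not weakly stable, a base `l` of largest modulus has |l| > 1. Its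
coefficient is nonzero because a nonzero integral functional kills no eigenvector of an irreducible
matrix (`dotProduct_ne_zero_of_mulVec_eq_smul`).

Other bases may share the modulus of `l`, so aₙ can be far smaller than |l|ⁿ. Total irreducibility
forbids quotients of eigenvalues that are roots of unity (`pow_ne_pow_of_isTotallyIrreducible`),
which confines such `n` to a set of small density (`eventually_card_norm_exponential_sum_lt_le`).
The remaining frequencies are essentially lacunary, so the mean squares in φ grow linearly, and
averages converge almost everywhere, first along squares and then in general. -/

/-! ### Sparsity of the small values of exponential sums -/

/-- Up to `N`, a set has at most `N / M + 1` members that are followed by no other member at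
distance less than `M`; the remaining members are counted by the shifts `1 ≤ h < M`. -/
theorem card_filter_range_le_add_sum_card_shift (p : ℕ → Prop) [DecidablePred p] (N M : ℕ)
    (hM : 0 < M) :
    ((Finset.range N).filter p).card ≤ (N / M + 1) +
      ∑ h ∈ Finset.Ico 1 M, ((Finset.range N).filter fun n => p n ∧ p (n + h)).card := by
  classical
  set I := (Finset.range N).filter fun n => p n ∧ ∀ h ∈ Finset.Ico 1 M, ¬ p (n + h) with hI
  have hcover : (Finset.range N).filter p ⊆ I ∪ (Finset.Ico 1 M).biUnion
      fun h => (Finset.range N).filter fun n => p n ∧ p (n + h) := by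
    intro n hn
    simp only [Finset.mem_filter, Finset.mem_union, Finset.mem_biUnion, hI] at hn ⊢
    by_cases hx : ∃ h ∈ Finset.Ico 1 M, p (n + h)
    · obtain ⟨h, hh, hp⟩ := hx
      exact Or.inr ⟨h, hh, hn.1, hn.2, hp⟩
    · push Not at hx
      exact Or.inl ⟨hn.1, hn.2, hx⟩
  have hcard : I.card ≤ N / M + 1 := by
    rw [← Finset.card_range (N / M + 1)]
    -- Two members of `I` in one block of length `M` would differ by less than `M`, so each block
    -- holds at most one.
    refine Finset.card_le_card_of_injOn (· / M) ?_ ?_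
    · intro n hn
      simp only [hI, Finset.coe_filter, Finset.mem_range, Set.mem_ofPred_eq] at hn
      simpa [Nat.lt_succ_iff] using Nat.div_le_div_right hn.1.le
    · have key : ∀ a ∈ I, ∀ b ∈ I, a / M = b / M → ¬ a < b := by
        intro a ha b hb hab hlt
        simp only [hI, Finset.mem_filter] at ha hb
        have h1 := Nat.div_add_mod a M
        have h2 := Nat.div_add_mod b M
        have h3 := Nat.mod_lt a hM
        have h4 := Nat.mod_lt b hM
        rw [hab] at h1
        refine ha.2.2 (b - a) (Finset.mem_Ico.2 ⟨by omega, by omega⟩) ?_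
        rw [Nat.add_sub_cancel' hlt.le]
        exact hb.2.1
      intro a ha b hb hab
      rcases lt_trichotomy a b with h | h | h
      · exact absurd h (key a ha b hb hab)
      · exact h
      · exact absurd h (key b hb a ha hab.symm)
  calc _ ≤ _ := Finset.card_le_card hcover
    _ ≤ _ := Finset.card_union_le _ _
    _ ≤ _ := add_le_add hcard Finset.card_biUnion_le

/-- An exponential sum `c λⁿ + ∑ b μⁿ` with dominant base `λ`, such that no quotient `μ / λ` is a
root of unity, is comparable with `|λ|ⁿ` outside a set of small upper density. -/
theorem eventually_card_norm_exponential_sum_lt_le {l : ℂ} (hl : 1 < ‖l‖) (s : Finset ℂ) :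
    (∀ μ ∈ s, ‖μ‖ ≤ ‖l‖ ∧ ∀ h : ℕ, 1 ≤ h → μ ^ h ≠ l ^ h) → ∀ (c : ℂ) (b : ℂ → ℂ), c ≠ 0 →
    ∀ ε : ℝ, 0 < ε → ∀ᶠ δ : ℝ in 𝓝[>] 0, ∀ᶠ N : ℕ in atTop,
      (((Finset.range N).filter fun n =>
        ‖c * l ^ n + ∑ μ ∈ s, b μ * μ ^ n‖ < δ * ‖l‖ ^ n).card : ℝ) ≤ ε * N := by
  classical
  induction s using Finset.induction_on with
  | empty =>
    intro _ c b hc ε hε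
    have hlt : ∀ᶠ δ : ℝ in 𝓝[>] 0, δ < ‖c‖ :=
      eventually_nhdsWithin_of_eventually_nhds (eventually_lt_nhds (norm_pos_iff.2 hc))
    filter_upwards [hlt] with δ hδ
    refine Eventually.of_forall fun N => ?_
    rw [Finset.filter_false_of_mem]
    · simp only [Finset.card_empty, Nat.cast_zero]
      positivity
    · intro n _
      rw [Finset.sum_empty, add_zero, norm_mul, norm_pow, not_lt]
      gcongr
  | insert m s hm ih =>
    intro hs c b hc ε hε
    have hs' : ∀ μ ∈ s, ‖μ‖ ≤ ‖l‖ ∧ ∀ h : ℕ, 1 ≤ h → μ ^ h ≠ l ^ h :=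
      fun μ hμ => hs μ (Finset.mem_insert_of_mem hμ)
    obtain ⟨hml, hmp⟩ := hs m (Finset.mem_insert_self _ _)
    obtain ⟨M, hM⟩ := exists_nat_gt (3 / ε)
    have hM0 : (0 : ℝ) < M := lt_trans (by positivity) hM
    have hMN : 0 < M := by exact_mod_cast hM0
    -- If g(n) and g(n+h) are both small, so is g(n+h) - mʰ g(n). This difference no longer contains
    -- the base `m`, and its coefficient c(lʰ - mʰ) at `l` is nonzero, so induction applies. The `M`
    -- shifts share ε/3; the isolated members and the rounding term take ε/3 each.
    have step : ∀ h ∈ Finset.Ico 1 M, ∀ᶠ δ : ℝ in 𝓝[>] 0, ∀ᶠ N : ℕ in atTop,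
        (((Finset.range N).filter fun n =>
          ‖c * (l ^ h - m ^ h) * l ^ n + ∑ μ ∈ s, b μ * (μ ^ h - m ^ h) * μ ^ n‖
            < 2 * ‖l‖ ^ h * δ * ‖l‖ ^ n).card : ℝ) ≤ ε / (3 * M) * N := by
      intro h hh
      have h0 : (0 : ℝ) < 2 * ‖l‖ ^ h := by positivity
      have ht : Tendsto (fun δ : ℝ => 2 * ‖l‖ ^ h * δ) (𝓝[>] 0) (𝓝[>] 0) := by
        refine tendsto_nhdsWithin_of_tendsto_nhds_of_eventually_within _ ?_ ?_
        · have : Tendsto (fun δ : ℝ => 2 * ‖l‖ ^ h * δ) (𝓝 0) (𝓝 (2 * ‖l‖ ^ h * 0)) :=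
            tendsto_id.const_mul _
          rw [mul_zero] at this
          exact this.mono_left nhdsWithin_le_nhds
        · filter_upwards [self_mem_nhdsWithin] with δ hδ
          exact mul_pos h0 hδ
      exact ht.eventually (ih hs' (c * (l ^ h - m ^ h)) (fun μ => b μ * (μ ^ h - m ^ h))
        (mul_ne_zero hc (sub_ne_zero.2 (hmp h (Finset.mem_Ico.1 hh).1).symm)) _ (by positivity))
    filter_upwards [(Filter.eventually_all_finset _).2 step] with δ hδ
    have hbig : ∀ᶠ N : ℕ in atTop, 3 / ε ≤ (N : ℝ) :=
      tendsto_natCast_atTop_atTop.eventually_ge_atTop _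
    filter_upwards [(Filter.eventually_all_finset _).2 hδ, hbig] with N hN hN1
    set g : ℕ → ℂ := fun n => c * l ^ n + ∑ μ ∈ insert m s, b μ * μ ^ n with hg
    have hdiff : ∀ h n, g (n + h) - m ^ h * g n =
        c * (l ^ h - m ^ h) * l ^ n + ∑ μ ∈ s, b μ * (μ ^ h - m ^ h) * μ ^ n := by
      intro h n
      simp only [hg, Finset.sum_insert hm]
      have : ∑ μ ∈ s, b μ * (μ ^ h - m ^ h) * μ ^ n =
          ∑ μ ∈ s, b μ * μ ^ (n + h) - m ^ h * ∑ μ ∈ s, b μ * μ ^ n := by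
        rw [Finset.mul_sum, ← Finset.sum_sub_distrib]
        exact Finset.sum_congr rfl fun μ _ => by ring
      rw [this]
      ring
    have hpair : ∀ h ∈ Finset.Ico 1 M, (((Finset.range N).filter fun n =>
        ‖g n‖ < δ * ‖l‖ ^ n ∧ ‖g (n + h)‖ < δ * ‖l‖ ^ (n + h)).card : ℝ) ≤ ε / (3 * M) * N := by
      intro h hh
      refine le_trans ?_ (hN h hh)
      norm_cast
      refine Finset.card_le_card fun n hn => ?_
      simp only [Finset.mem_filter] at hn ⊢
      refine ⟨hn.1, ?_⟩
      rw [← hdiff]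
      calc ‖g (n + h) - m ^ h * g n‖ ≤ ‖g (n + h)‖ + ‖m ^ h * g n‖ := norm_sub_le _ _
        _ ≤ ‖g (n + h)‖ + ‖l‖ ^ h * ‖g n‖ := by
          rw [norm_mul, norm_pow]
          gcongr
        _ < δ * ‖l‖ ^ (n + h) + ‖l‖ ^ h * (δ * ‖l‖ ^ n) := by
          have h0 : (0 : ℝ) < ‖l‖ ^ h := by positivity
          exact add_lt_add hn.2.2 (mul_lt_mul_of_pos_left hn.2.1 h0)
        _ = _ := by ring
    have hcount := card_filter_range_le_add_sum_card_shift
      (fun n => ‖g n‖ < δ * ‖l‖ ^ n) N M hMN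
    have hdiv : ((N / M : ℕ) : ℝ) ≤ ε / 3 * N := by
      refine Nat.cast_div_le.trans ?_
      rw [div_le_iff₀ hM0]
      have : 1 ≤ ε / 3 * M := by
        rw [div_lt_iff₀ hε] at hM
        linarith
      nlinarith [(Nat.cast_nonneg N : (0 : ℝ) ≤ N)]
    have hone : 1 ≤ ε / 3 * N := by
      rw [div_le_iff₀ hε] at hN1
      linarith
    have hsum : ∑ h ∈ Finset.Ico 1 M, (((Finset.range N).filter fun n =>
        ‖g n‖ < δ * ‖l‖ ^ n ∧ ‖g (n + h)‖ < δ * ‖l‖ ^ (n + h)).card : ℝ) ≤ ε / 3 * N := by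
      refine (Finset.sum_le_card_nsmul _ _ _ hpair).trans ?_
      rw [nsmul_eq_mul, Nat.card_Ico]
      have h1 : ((M - 1 : ℕ) : ℝ) ≤ M := by exact_mod_cast Nat.sub_le _ _
      calc ((M - 1 : ℕ) : ℝ) * (ε / (3 * M) * N) ≤ M * (ε / (3 * M) * N) := by gcongr
        _ = ε / 3 * N := by field_simp
    have hcount' : (((Finset.range N).filter fun n => ‖g n‖ < δ * ‖l‖ ^ n).card : ℝ) ≤
        ((N / M : ℕ) : ℝ) + 1 + ∑ h ∈ Finset.Ico 1 M, (((Finset.range N).filter fun n =>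
        ‖g n‖ < δ * ‖l‖ ^ n ∧ ‖g (n + h)‖ < δ * ‖l‖ ^ (n + h)).card : ℝ) := by
      exact_mod_cast hcount
    linarith

/-! ### Mean squares and almost everywhere convergence -/

/-- If partial sums of functions of norm at most one have mean squares of linear growth, then
their averages tend to zero almost everywhere. -/
theorem ae_tendsto_average_of_integral_sq_le {Ω : Type*} [MeasurableSpace Ω] {μ : Measure Ω}
    [IsFiniteMeasure μ] (u : ℕ → Ω → ℂ) (hu : ∀ n, Measurable (u n)) (hb : ∀ n ω, ‖u n ω‖ ≤ 1)
    (C : ℝ) (hC : ∀ N : ℕ, ∫ ω, ‖∑ n ∈ Finset.range N, u n ω‖ ^ 2 ∂μ ≤ C * N) :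
    ∀ᵐ ω ∂μ, Tendsto (fun N : ℕ => (1 / (N : ℂ)) * ∑ n ∈ Finset.range N, u n ω) atTop (𝓝 0) := by
  set F : ℕ → Ω → ℂ := fun N ω => ∑ n ∈ Finset.range N, u n ω with hF
  have hFm : ∀ N, Measurable (F N) := fun N => Finset.measurable_fun_sum _ fun n _ => hu n
  have hFb : ∀ N ω, ‖F N ω‖ ≤ N := fun N ω => by
    refine (norm_sum_le_of_le _ fun n _ => hb n ω).trans ?_
    simp
  have hFi : ∀ N, Integrable (fun ω => ‖F N ω‖ ^ 2) μ := fun N =>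
    Integrable.of_bound ((hFm N).norm.pow_const 2).aestronglyMeasurable ((N : ℝ) ^ 2)
      (Eventually.of_forall fun ω => by
        rw [Real.norm_of_nonneg (by positivity)]
        gcongr
        exact hFb N ω)
  -- Along N = j² the averages have second moment at most C/j², which is summable.
  set q : ℕ → Ω → ENNReal := fun j ω => ENNReal.ofReal (‖F (j ^ 2) ω‖ ^ 2 / (j : ℝ) ^ 4) with hq
  have hqm : ∀ j, Measurable (q j) := fun j =>
    (((hFm (j ^ 2)).norm.pow_const 2).div_const _).ennreal_ofReal
  have hqi : ∀ j, ∫⁻ ω, q j ω ∂μ ≤ ENNReal.ofReal (C * (1 / (j : ℝ) ^ 2)) := by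
    intro j
    rw [hq, ← ofReal_integral_eq_lintegral_ofReal ((hFi (j ^ 2)).div_const _)
      (Eventually.of_forall fun ω => by positivity), integral_div]
    refine ENNReal.ofReal_le_ofReal ?_
    rcases Nat.eq_zero_or_pos j with rfl | hj
    · simp
    · have hj' : (0 : ℝ) < j := by exact_mod_cast hj
      rw [div_le_iff₀ (by positivity)]
      refine (hC (j ^ 2)).trans (le_of_eq ?_)
      push_cast
      field_simp
  have hsum : ∫⁻ ω, ∑' j, q j ω ∂μ ≠ ⊤ := by
    rw [lintegral_tsum fun j => (hqm j).aemeasurable]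
    have h1 : Summable fun j : ℕ => C * (1 / (j : ℝ) ^ 2) :=
      (Real.summable_one_div_nat_pow.2 one_lt_two).mul_left C
    exact ne_top_of_le_ne_top h1.tsum_ofReal_ne_top (ENNReal.tsum_le_tsum hqi)
  filter_upwards [ae_lt_top' (Measurable.tsum hqm).aemeasurable hsum] with ω hω
  have h0 := ENNReal.tendsto_atTop_zero_of_tsum_ne_top hω.ne
  have h1 : Tendsto (fun j : ℕ => ‖F (j ^ 2) ω‖ / (j : ℝ) ^ 2) atTop (𝓝 0) := by
    have h2 := ((ENNReal.tendsto_toReal ENNReal.zero_ne_top).comp h0).sqrt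
    simp only [ENNReal.toReal_zero, Real.sqrt_zero] at h2
    refine h2.congr fun j => ?_
    simp only [hq, Function.comp_apply]
    rw [ENNReal.toReal_ofReal (by positivity),
      show ‖F (j ^ 2) ω‖ ^ 2 / (j : ℝ) ^ 4 = (‖F (j ^ 2) ω‖ / (j : ℝ) ^ 2) ^ 2 by ring,
      Real.sqrt_sq (by positivity)]
  have h2 : Tendsto (fun j : ℕ => ‖F (j ^ 2) ω‖ / (j : ℝ) ^ 2 + 2 * (1 / (j : ℝ))) atTop (𝓝 0) := by
    simpa using h1.add ((tendsto_one_div_atTop_nhds_zero_nat (𝕜 := ℝ)).const_mul 2)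
  have hsqrt : Tendsto Nat.sqrt atTop atTop :=
    tendsto_atTop_atTop.2 fun b => ⟨b ^ 2, fun a ha => Nat.le_sqrt'.2 ha⟩
  -- With j = ⌊√N⌋, at most 2j terms lie between j² and `N`; they change the average by at most 2/j.
  refine squeeze_zero_norm' ?_ (h2.comp hsqrt)
  filter_upwards [eventually_ge_atTop 1] with N hN
  have hj : 0 < Nat.sqrt N := Nat.sqrt_pos.2 hN
  have hle : Nat.sqrt N ^ 2 ≤ N := Nat.sqrt_le' N
  have hlt : N ≤ Nat.sqrt N ^ 2 + 2 * Nat.sqrt N := by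
    have := Nat.sqrt_le_add N
    nlinarith
  simp only [Function.comp_apply]
  generalize Nat.sqrt N = j at hj hle hlt
  have hj' : (0 : ℝ) < j := by exact_mod_cast hj
  have hle' : (j : ℝ) ^ 2 ≤ N := by exact_mod_cast hle
  have hlt' : (N : ℝ) ≤ (j : ℝ) ^ 2 + 2 * j := by exact_mod_cast hlt
  have hsub : ‖F N ω‖ ≤ ‖F (j ^ 2) ω‖ + 2 * j := by
    have h3 : F N ω = F (j ^ 2) ω + ∑ n ∈ Finset.Ico (j ^ 2) N, u n ω :=
      (Finset.sum_range_add_sum_Ico _ hle).symm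
    rw [h3]
    refine (norm_add_le _ _).trans (add_le_add le_rfl ?_)
    refine (norm_sum_le_of_le _ fun n _ => hb n ω).trans ?_
    simp only [Finset.sum_const, Nat.card_Ico, nsmul_eq_mul, mul_one]
    rw [Nat.cast_sub hle]
    push_cast
    linarith
  rw [norm_mul, norm_div, norm_one, Complex.norm_natCast, one_div_mul_eq_div]
  calc ‖F N ω‖ / N ≤ (‖F (j ^ 2) ω‖ + 2 * j) / (j : ℝ) ^ 2 := by gcongr
    _ = _ := by field_simp

/-- The oscillation of `φ ↦ e(φ t)` over the unit interval around zero. -/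
theorem norm_integral_exp_le (t : ℝ) :
    ‖∫ φ in (-(1 / 2) : ℝ)..(1 / 2), Complex.exp (2 * Real.pi * Complex.I * (φ * t))‖ ≤
      1 ∧ (t ≠ 0 →
    ‖∫ φ in (-(1 / 2) : ℝ)..(1 / 2), Complex.exp (2 * Real.pi * Complex.I * (φ * t))‖ ≤
      1 / |t|) := by
  have hn : ∀ φ : ℝ, ‖Complex.exp (2 * Real.pi * Complex.I * (φ * t))‖ = 1 := fun φ => by
    rw [show (2 * Real.pi * Complex.I * (φ * t) : ℂ) = ((2 * Real.pi * (φ * t) : ℝ) : ℂ) *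
      Complex.I by push_cast; ring, Complex.norm_exp_ofReal_mul_I]
  constructor
  · refine (intervalIntegral.norm_integral_le_of_norm_le_const fun φ _ => (hn φ).le).trans ?_
    norm_num
  · intro ht
    have hc : (2 * Real.pi * Complex.I * t : ℂ) ≠ 0 := by
      simp [Real.pi_ne_zero, ht]
    have : ∀ φ : ℝ, Complex.exp (2 * Real.pi * Complex.I * (φ * t)) =
        Complex.exp ((2 * Real.pi * Complex.I * t) * φ) := fun φ => by ring_nf
    simp only [this] at hn ⊢
    rw [integral_exp_mul_complex hc, norm_div]
    have hden : ‖(2 * Real.pi * Complex.I * t : ℂ)‖ = 2 * Real.pi * |t| := by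
      simp [abs_of_pos Real.pi_pos]
    have ht' : 0 < |t| := abs_pos.2 ht
    rw [hden, div_le_div_iff₀ (by positivity) ht', one_mul]
    gcongr
    refine (norm_sub_le _ _).trans ?_
    rw [hn, hn]
    linarith [Real.pi_gt_three]

/-- The mean square of an exponential sum with unimodular coefficients. -/
theorem integral_norm_sq_exponential_sum_le (T : Finset ℕ) (u : ℕ → ℂ) (hu : ∀ n, ‖u n‖ = 1)
    (a : ℕ → ℝ) :
    ∫ φ in (-(1 / 2) : ℝ)..(1 / 2),
      ‖∑ n ∈ T, u n * Complex.exp (2 * Real.pi * Complex.I * (φ * a n))‖ ^ 2 ≤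
    ∑ n ∈ T, ∑ m ∈ T, ‖∫ φ in (-(1 / 2) : ℝ)..(1 / 2),
      Complex.exp (2 * Real.pi * Complex.I * (φ * (a n - a m : ℝ)))‖ := by
  have hexp : ∀ φ : ℝ,
      ((‖∑ n ∈ T, u n * Complex.exp (2 * Real.pi * Complex.I * (φ * a n))‖ ^ 2 : ℝ) : ℂ) =
      ∑ n ∈ T, ∑ m ∈ T, u n * (starRingEnd ℂ) (u m) *
        Complex.exp (2 * Real.pi * Complex.I * (φ * (a n - a m : ℝ))) := by
    intro φ
    push_cast
    rw [← Complex.mul_conj', map_sum, Finset.sum_mul_sum]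
    refine Finset.sum_congr rfl fun n _ => Finset.sum_congr rfl fun m _ => ?_
    rw [map_mul, ← Complex.exp_conj, mul_mul_mul_comm, ← Complex.exp_add]
    congr 2
    simp only [map_mul, Complex.conj_ofReal, Complex.conj_I, map_ofNat]
    ring
  have hint : ∀ n m, IntervalIntegrable (fun φ : ℝ => u n * (starRingEnd ℂ) (u m) *
      Complex.exp (2 * Real.pi * Complex.I * (φ * (a n - a m : ℝ)))) volume (-(1 / 2)) (1 / 2) :=
    fun n m => Continuous.intervalIntegrable (by fun_prop) _ _
  have heq : ((∫ φ in (-(1 / 2) : ℝ)..(1 / 2),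
      ‖∑ n ∈ T, u n * Complex.exp (2 * Real.pi * Complex.I * (φ * a n))‖ ^ 2 : ℝ) : ℂ) =
      ∑ n ∈ T, ∑ m ∈ T, u n * (starRingEnd ℂ) (u m) * ∫ φ in (-(1 / 2) : ℝ)..(1 / 2),
        Complex.exp (2 * Real.pi * Complex.I * (φ * (a n - a m : ℝ))) := by
    rw [← intervalIntegral.integral_ofReal]
    simp only [hexp]
    rw [intervalIntegral.integral_finsetSum fun n _ => ?_]
    · refine Finset.sum_congr rfl fun n _ => ?_
      rw [intervalIntegral.integral_finsetSum fun m _ => hint n m]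
      exact Finset.sum_congr rfl fun m _ => intervalIntegral.integral_const_mul _ _
    · exact Continuous.intervalIntegrable (by fun_prop) _ _
  refine (le_abs_self _).trans ?_
  rw [← Real.norm_eq_abs, ← Complex.norm_real, heq]
  refine (norm_sum_le _ _).trans (Finset.sum_le_sum fun n _ => (norm_sum_le _ _).trans
    (Finset.sum_le_sum fun m _ => ?_))
  rw [norm_mul, norm_mul, hu, RCLike.norm_conj, hu, one_mul, one_mul]

/-- Frequencies of exact exponential growth behave like a lacunary sequence: the mean squares of
the associated exponential sums grow linearly. -/
theorem exists_integral_norm_sq_le_of_exponential_growth {ρ δ C : ℝ} (hρ : 1 < ρ) (hδ : 0 < δ)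
    (a : ℕ → ℝ) (hC : ∀ n, |a n| ≤ C * ρ ^ n) (u : ℕ → ℂ) (hu : ∀ n, ‖u n‖ = 1) :
    ∃ D : ℝ, ∀ (N : ℕ) (T : Finset ℕ), T ⊆ Finset.range N → (∀ n ∈ T, δ * ρ ^ n ≤ |a n|) →
    ∫ φ in (-(1 / 2) : ℝ)..(1 / 2),
      ‖∑ n ∈ T, u n * Complex.exp (2 * Real.pi * Complex.I * (φ * a n))‖ ^ 2 ≤ D * N := by
  classical
  -- `L` is a gap beyond which the smaller frequency is at most half of the larger one.
  obtain ⟨L, hL⟩ := pow_unbounded_of_one_lt (2 * C / δ) hρ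
  rw [div_lt_iff₀ hδ] at hL
  have hρ0 : 0 < ρ := zero_lt_one.trans hρ
  have hr0 : 0 ≤ ρ⁻¹ := by positivity
  have hr1 : ρ⁻¹ < 1 := inv_lt_one_of_one_lt₀ hρ
  have hr2 : 0 < 1 - ρ⁻¹ := by linarith
  -- Pairs of indices closer than `L` contribute 2L per row; the other pairs contribute two
  -- geometric series, one in each index.
  refine ⟨2 * L + 2 * (2 / δ * (1 - ρ⁻¹)⁻¹), fun N T hTN hT => ?_⟩
  refine (integral_norm_sq_exponential_sum_le T u hu a).trans ?_
  set K : ℕ → ℕ → ℝ := fun n m => ‖∫ φ in (-(1 / 2) : ℝ)..(1 / 2),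
    Complex.exp (2 * Real.pi * Complex.I * (φ * (a n - a m : ℝ)))‖ with hK
  have hsep : ∀ n ∈ T, ∀ m, m + L ≤ n → δ / 2 * ρ ^ n ≤ |a n - a m| := by
    intro n hn m hmn
    have h1 := abs_sub_abs_le_abs_sub (a n) (a m)
    have h2 : C * ρ ^ m ≤ δ / 2 * ρ ^ n := by
      calc C * ρ ^ m ≤ (δ / 2 * ρ ^ L) * ρ ^ m := by
            gcongr
            linarith
        _ = δ / 2 * ρ ^ (m + L) := by ring
        _ ≤ _ := by gcongr; exact hρ.le
    have h3 := hT n hn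
    have h4 := hC m
    linarith
  have hrec : ∀ (n : ℕ) (t : ℝ), δ / 2 * ρ ^ n ≤ |t| →
      t ≠ 0 ∧ 1 / |t| ≤ 2 / δ * ρ⁻¹ ^ n := by
    intro n t ht
    have h0 : 0 < δ / 2 * ρ ^ n := by positivity
    refine ⟨abs_pos.1 (h0.trans_le ht), (one_div_le_one_div_of_le h0 ht).trans (le_of_eq ?_)⟩
    rw [inv_pow]
    field_simp
  -- Both geometric terms are kept whichever index is larger, so that the double sum separates.
  have hKb : ∀ n ∈ T, ∀ m ∈ T, K n m ≤
      (if n < m + L ∧ m < n + L then 1 else 0) + 2 / δ * ρ⁻¹ ^ n + 2 / δ * ρ⁻¹ ^ m := by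
    intro n hn m hm
    have hpn : 0 ≤ 2 / δ * ρ⁻¹ ^ n := by positivity
    have hpm : 0 ≤ 2 / δ * ρ⁻¹ ^ m := by positivity
    split_ifs with h
    · linarith [(norm_integral_exp_le (a n - a m)).1]
    · rcases Nat.lt_or_ge n (m + L) with h1 | h1
      · have h2 : n + L ≤ m := by
          by_contra h3
          exact h ⟨h1, by omega⟩
        have h3 := hrec m (a n - a m) (by rw [abs_sub_comm]; exact hsep m hm n h2)
        linarith [(norm_integral_exp_le (a n - a m)).2 h3.1]
      · have h3 := hrec n (a n - a m) (hsep n hn m h1)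
        linarith [(norm_integral_exp_le (a n - a m)).2 h3.1]
  have hTc : (T.card : ℝ) ≤ N := by
    exact_mod_cast (Finset.card_le_card hTN).trans_eq (Finset.card_range N)
  have hgeo : ∑ n ∈ T, 2 / δ * ρ⁻¹ ^ n ≤ 2 / δ * (1 - ρ⁻¹)⁻¹ := by
    rw [← Finset.mul_sum, ← tsum_geometric_of_lt_one hr0 hr1]
    gcongr
    exact (summable_geometric_of_lt_one hr0 hr1).sum_le_tsum _ fun n _ => by positivity
  have hnear : ∀ n, ∑ m ∈ T, (if n < m + L ∧ m < n + L then (1 : ℝ) else 0) ≤ 2 * L := by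
    intro n
    rw [Finset.sum_boole]
    have : (T.filter fun m => n < m + L ∧ m < n + L).card ≤ (Finset.Ico (n - L) (n + L)).card :=
      Finset.card_le_card fun m hm => by
        simp only [Finset.mem_filter, Finset.mem_Ico] at hm ⊢
        omega
    rw [Nat.card_Ico] at this
    exact_mod_cast this.trans (by omega)
  have hgeo0 : 0 ≤ 2 / δ * (1 - ρ⁻¹)⁻¹ := by positivity
  calc ∑ n ∈ T, ∑ m ∈ T, K n m
      ≤ ∑ n ∈ T, ∑ m ∈ T, ((if n < m + L ∧ m < n + L then (1 : ℝ) else 0) +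
          2 / δ * ρ⁻¹ ^ n + 2 / δ * ρ⁻¹ ^ m) :=
        Finset.sum_le_sum fun n hn => Finset.sum_le_sum fun m hm => hKb n hn m hm
    _ = ∑ n ∈ T, ∑ m ∈ T, (if n < m + L ∧ m < n + L then (1 : ℝ) else 0) +
          T.card * ∑ n ∈ T, 2 / δ * ρ⁻¹ ^ n + T.card * ∑ m ∈ T, 2 / δ * ρ⁻¹ ^ m := by
        simp only [Finset.sum_add_distrib, Finset.sum_const, nsmul_eq_mul, Finset.mul_sum]
    _ ≤ N * (2 * L) + N * (2 / δ * (1 - ρ⁻¹)⁻¹) + N * (2 / δ * (1 - ρ⁻¹)⁻¹) := by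
        have h1 : ∑ n ∈ T, ∑ m ∈ T, (if n < m + L ∧ m < n + L then (1 : ℝ) else 0) ≤
            N * (2 * L) := by
          refine (Finset.sum_le_card_nsmul _ _ _ fun n _ => hnear n).trans ?_
          rw [nsmul_eq_mul]
          gcongr
        have h2 : (T.card : ℝ) * ∑ n ∈ T, 2 / δ * ρ⁻¹ ^ n ≤ N * (2 / δ * (1 - ρ⁻¹)⁻¹) := by
          gcongr
        linarith
    _ = _ := by ring

/-- Exponential sums whose frequencies are an exponential polynomial with a dominant base of
modulus greater than one average to zero almost everywhere. -/
theorem ae_tendsto_average_exponential_sum {l : ℂ} (hl : 1 < ‖l‖) (s : Finset ℂ)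
    (hs : ∀ μ ∈ s, ‖μ‖ ≤ ‖l‖ ∧ ∀ h : ℕ, 1 ≤ h → μ ^ h ≠ l ^ h) (c : ℂ) (b : ℂ → ℂ) (hc : c ≠ 0)
    (a : ℕ → ℝ) (ha : ∀ n, (a n : ℂ) = c * l ^ n + ∑ μ ∈ s, b μ * μ ^ n)
    (u : ℕ → ℂ) (hu : ∀ n, ‖u n‖ = 1) :
    ∀ᵐ φ : ℝ ∂(volume.restrict (Set.Icc (-(1 / 2) : ℝ) (1 / 2))),
      Tendsto (fun N : ℕ => (1 / (N : ℂ)) *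
        ∑ n ∈ Finset.range N, u n * Complex.exp (2 * Real.pi * Complex.I * (φ * a n)))
        atTop (𝓝 0) := by
  classical
  have hn : ∀ (φ : ℝ) n, ‖u n * Complex.exp (2 * Real.pi * Complex.I * (φ * a n))‖ = 1 := by
    intro φ n
    rw [norm_mul, hu, one_mul,
      show (2 * Real.pi * Complex.I * (φ * a n) : ℂ) = ((2 * Real.pi * (φ * a n) : ℝ) : ℂ) *
      Complex.I by push_cast; ring, Complex.norm_exp_ofReal_mul_I]
  have hupper : ∀ n, |a n| ≤ (‖c‖ + ∑ μ ∈ s, ‖b μ‖) * ‖l‖ ^ n := by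
    intro n
    rw [← Real.norm_eq_abs, ← Complex.norm_real, ha, add_mul, Finset.sum_mul]
    refine (norm_add_le _ _).trans (add_le_add (by rw [norm_mul, norm_pow]) ?_)
    refine norm_sum_le_of_le _ fun μ hμ => ?_
    rw [norm_mul, norm_pow]
    have := (hs μ hμ).1
    gcongr
  -- Restricting the density to the values 1/(k+1) leaves only countably many null sets to discard.
  have hdens : ∀ k : ℕ, ∃ δ : ℝ, 0 < δ ∧ ∀ᶠ N : ℕ in atTop,
      (((Finset.range N).filter fun n => |a n| < δ * ‖l‖ ^ n).card : ℝ) ≤ 1 / (k + 1 : ℝ) * N := by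
    intro k
    have h1 := eventually_card_norm_exponential_sum_lt_le hl s hs c b hc (1 / (k + 1 : ℝ))
      (by positivity)
    obtain ⟨δ, hδ, hδ0⟩ := (h1.and self_mem_nhdsWithin).exists
    refine ⟨δ, hδ0, ?_⟩
    simp only [← ha, Complex.norm_real, Real.norm_eq_abs] at hδ
    exact hδ
  choose δ hδ0 hδ using hdens
  have hgood : ∀ k : ℕ, ∀ᵐ φ : ℝ ∂(volume.restrict (Set.Icc (-(1 / 2) : ℝ) (1 / 2))),
      Tendsto (fun N : ℕ => (1 / (N : ℂ)) * ∑ n ∈ Finset.range N,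
        if |a n| < δ k * ‖l‖ ^ n then 0 else
          u n * Complex.exp (2 * Real.pi * Complex.I * (φ * a n))) atTop (𝓝 0) := by
    intro k
    obtain ⟨D, hD⟩ := exists_integral_norm_sq_le_of_exponential_growth hl (hδ0 k) a hupper u hu
    refine ae_tendsto_average_of_integral_sq_le (fun n (φ : ℝ) =>
        if |a n| < δ k * ‖l‖ ^ n then 0 else
          u n * Complex.exp (2 * Real.pi * Complex.I * (φ * a n))) (fun n => ?_)
        (fun n φ => ?_) D (fun N => ?_)
    · split_ifs
      · exact measurable_const
      · exact Continuous.measurable (by fun_prop)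
    · split_ifs
      · simp
      · exact (hn φ n).le
    · rw [integral_Icc_eq_integral_Ioc, ← intervalIntegral.integral_of_le (by norm_num)]
      have h1 := hD N ((Finset.range N).filter fun n => ¬ |a n| < δ k * ‖l‖ ^ n)
        (Finset.filter_subset _ _) fun n hn => not_lt.1 (Finset.mem_filter.1 hn).2
      simpa only [Finset.sum_filter, ite_not] using h1
  filter_upwards [ae_all_iff.2 hgood] with φ hφ
  rw [Metric.tendsto_nhds]
  intro ε hε
  obtain ⟨k, hk⟩ := exists_nat_one_div_lt (half_pos hε)
  filter_upwards [hδ k, (Metric.tendsto_nhds.1 (hφ k)) (ε / 2) (half_pos hε),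
    eventually_gt_atTop 0] with N hN1 hN2 hN0
  rw [dist_zero_right] at hN2 ⊢
  have hN0' : (0 : ℝ) < N := by exact_mod_cast hN0
  have hsplit : ∑ n ∈ Finset.range N, u n * Complex.exp (2 * Real.pi * Complex.I * (φ * a n)) =
      (∑ n ∈ Finset.range N, if |a n| < δ k * ‖l‖ ^ n then 0 else
          u n * Complex.exp (2 * Real.pi * Complex.I * (φ * a n))) +
      ∑ n ∈ (Finset.range N).filter fun n => |a n| < δ k * ‖l‖ ^ n,
        u n * Complex.exp (2 * Real.pi * Complex.I * (φ * a n)) := by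
    rw [Finset.sum_filter, ← Finset.sum_add_distrib]
    refine Finset.sum_congr rfl fun n _ => ?_
    split_ifs <;> simp
  have hbad : ‖(1 / (N : ℂ)) * ∑ n ∈ (Finset.range N).filter fun n => |a n| < δ k * ‖l‖ ^ n,
        u n * Complex.exp (2 * Real.pi * Complex.I * (φ * a n))‖ ≤ 1 / (k + 1 : ℝ) := by
    rw [norm_mul, norm_div, norm_one, Complex.norm_natCast, one_div_mul_eq_div,
      div_le_iff₀ hN0']
    refine le_trans ?_ hN1
    refine (norm_sum_le_of_le _ fun n _ => (hn φ n).le).trans ?_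
    simp
  rw [hsplit, mul_add]
  refine (norm_add_le _ _).trans_lt ?_
  linarith

/-! ### Eigenvectors of irreducible integer matrices -/

open Matrix in
/-- A nonzero row vector is cyclic for a matrix with irreducible characteristic polynomial. -/
theorem det_krylov_ne_zero {d : ℕ} {K : Type*} [Field K] (A : Matrix (Fin d) (Fin d) K)
    (hA : Irreducible A.charpoly) (k : Fin d → K) (hk : k ≠ 0) :
    (Matrix.of fun i : Fin d => k ᵥ* A ^ (i : ℕ)).det ≠ 0 := by
  intro h0
  obtain ⟨g, hg0, hg⟩ := Matrix.exists_vecMul_eq_zero_iff.2 h0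
  -- A relation between the rows says that `k` is killed by p(A) with deg p < d. Such a `p` is
  -- coprime to the characteristic polynomial, so p(A) is invertible and k = 0.
  set p : Polynomial K := ∑ i : Fin d, Polynomial.C (g i) * Polynomial.X ^ (i : ℕ) with hp
  have hpdeg : p.degree < d := Polynomial.degree_sum_fin_lt g
  have hp0 : p ≠ 0 := by
    intro h
    refine hg0 (funext fun i => ?_)
    have h1 : p.coeff i = 0 := by rw [h, Polynomial.coeff_zero]
    simpa [hp, Polynomial.finsetSum_coeff, Polynomial.coeff_C_mul, Polynomial.coeff_X_pow,
      Fin.val_inj] using h1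
  have hkp : k ᵥ* Polynomial.aeval A p = 0 := by
    rw [← hg]
    ext j
    simp only [hp, map_sum, map_mul, Polynomial.aeval_C, map_pow, Polynomial.aeval_X,
      ← Algebra.smul_def, Matrix.vecMul_sum, Matrix.vecMul_smul, Finset.sum_apply, Pi.smul_apply,
      smul_eq_mul]
    rfl
  have hdvd : ¬ A.charpoly ∣ p := fun h => by
    have := Polynomial.degree_le_of_dvd h hp0
    rw [Matrix.charpoly_degree_eq_dim, Fintype.card_fin] at this
    exact absurd hpdeg (not_lt.2 this)
  obtain ⟨q, r, hqr⟩ := (hA.coprime_iff_not_dvd).2 hdvd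
  have h1 : Polynomial.aeval A p * Polynomial.aeval A r = 1 := by
    have := congrArg (Polynomial.aeval A) hqr
    rwa [map_add, map_mul, Matrix.aeval_self_charpoly, mul_zero, zero_add, map_one, mul_comm r p,
      map_mul] at this
  refine hk ?_
  rw [← Matrix.vecMul_one k, ← h1, ← Matrix.vecMul_vecMul, hkp, Matrix.zero_vecMul]

open Matrix in
/-- A nonzero integral functional does not vanish on an eigenvector of an irreducible integer
matrix. -/
theorem dotProduct_ne_zero_of_mulVec_eq_smul {d : ℕ} {S : Matrix (Fin d) (Fin d) ℤ}
    (hS : IsIrreducibleMatrix S) {k : Fin d → ℤ} (hk : k ≠ 0) {v : Fin d → ℂ} (hv : v ≠ 0) {μ : ℂ}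
    (hμ : S.map (Int.castRingHom ℂ) *ᵥ v = μ • v) : (fun i => (k i : ℂ)) ⬝ᵥ v ≠ 0 := by
  intro h0
  set A : Matrix (Fin d) (Fin d) ℚ := S.map (Int.castRingHom ℚ) with hA
  set κ : Fin d → ℚ := fun i => (k i : ℚ) with hκ
  have hirr : Irreducible A.charpoly := by
    rw [hA, Matrix.charpoly_map]
    exact hS
  have hκ0 : κ ≠ 0 := fun h => hk (funext fun i => by
    have := congrFun h i
    simpa [hκ] using this)
  have hdet := det_krylov_ne_zero A hirr κ hκ0
  have hAC : A.map (algebraMap ℚ ℂ) = S.map (Int.castRingHom ℂ) := by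
    ext i j
    simp [hA]
  have hdetC : ((Matrix.of fun i : Fin d => κ ᵥ* A ^ (i : ℕ)).map (algebraMap ℚ ℂ)).det ≠ 0 := by
    change ((algebraMap ℚ ℂ).mapMatrix _).det ≠ 0
    rw [← RingHom.map_det]
    simpa using hdet
  -- If k·v = 0, every row k Sⁱ also kills `v`, since k Sⁱ v = μⁱ (k·v); but these rows form an
  -- invertible matrix.
  refine hv (Matrix.eq_zero_of_mulVec_eq_zero hdetC (funext fun i => ?_))
  have hrow : ((Matrix.of fun i : Fin d => κ ᵥ* A ^ (i : ℕ)).map (algebraMap ℚ ℂ)) i =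
      (fun i => (k i : ℂ)) ᵥ* (S.map (Int.castRingHom ℂ)) ^ (i : ℕ) := by
    ext j
    rw [← hAC, ← Matrix.map_pow, Matrix.map_apply, Matrix.of_apply, RingHom.map_vecMul,
      show ⇑(algebraMap ℚ ℂ) ∘ κ = fun i => (k i : ℂ) from funext fun i => by simp [hκ]]
  have hpow : ∀ n : ℕ, (S.map (Int.castRingHom ℂ)) ^ n *ᵥ v = μ ^ n • v := by
    intro n
    induction n with
    | zero => simp
    | succ n ih => rw [pow_succ, ← Matrix.mulVec_mulVec, hμ, Matrix.mulVec_smul, ih, smul_smul,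
        pow_succ, mul_comm]
  rw [Matrix.mulVec, hrow, ← Matrix.dotProduct_mulVec, hpow, dotProduct_smul, h0, smul_zero,
    Pi.zero_apply]

open Matrix in
theorem map_pow_mulVec_of_mem_eigenspace {d : ℕ} (S : Matrix (Fin d) (Fin d) ℤ) {μ : ℂ}
    {v : Fin d → ℂ} (hv : v ∈ (complexMap S).eigenspace μ) (n : ℕ) :
    (S ^ n).map (Int.castRingHom ℂ) *ᵥ v = μ ^ n • v := by
  have h1 : S.map (Int.castRingHom ℂ) *ᵥ v = μ • v := Module.End.mem_eigenspace_iff.1 hv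
  rw [Matrix.map_pow]
  induction n with
  | zero => simp
  | succ n ih => rw [pow_succ, ← Matrix.mulVec_mulVec, h1, Matrix.mulVec_smul, ih, smul_smul,
      pow_succ, mul_comm]

open Matrix in
/-- Quotients of distinct eigenvalues of a totally irreducible matrix are not roots of unity. -/
theorem pow_ne_pow_of_isTotallyIrreducible {d : ℕ} {S : Matrix (Fin d) (Fin d) ℤ}
    (hS : IsTotallyIrreducible S) {μ ν : ℂ} (hμν : μ ≠ ν) {v w : Fin d → ℂ}
    (hv : v ∈ (complexMap S).eigenspace μ) (hv0 : v ≠ 0)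
    (hw : w ∈ (complexMap S).eigenspace ν) (hw0 : w ≠ 0) {h : ℕ} (hh : 1 ≤ h) :
    μ ^ h ≠ ν ^ h := by
  intro heq
  have hd : d ≠ 0 := by
    rintro rfl
    exact hv0 (Subsingleton.elim _ _)
  have : NeZero d := ⟨hd⟩
  set k : Fin d → ℤ := 1 with hkdef
  have hk : k ≠ 0 := one_ne_zero
  set κ : Fin d → ℂ := fun i => (k i : ℂ) with hκ
  have h1 : S.map (Int.castRingHom ℂ) *ᵥ v = μ • v := Module.End.mem_eigenspace_iff.1 hv
  have h2 : S.map (Int.castRingHom ℂ) *ᵥ w = ν • w := Module.End.mem_eigenspace_iff.1 hw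
  have hS1 : IsIrreducibleMatrix S := by simpa using hS 1 le_rfl
  have hkv : κ ⬝ᵥ v ≠ 0 := dotProduct_ne_zero_of_mulVec_eq_smul hS1 hk hv0 h1
  have hkw : κ ⬝ᵥ w ≠ 0 := dotProduct_ne_zero_of_mulVec_eq_smul hS1 hk hw0 h2
  -- If μʰ = νʰ, this combination is zero or an eigenvector of Sʰ. Being killed by `k`, it is zero,
  -- so `v` and `w` are proportional, which μ ≠ ν forbids.
  set z : Fin d → ℂ := (κ ⬝ᵥ w) • v - (κ ⬝ᵥ v) • w with hz
  have hzk : κ ⬝ᵥ z = 0 := by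
    rw [hz, dotProduct_sub, dotProduct_smul, dotProduct_smul, smul_eq_mul, smul_eq_mul, mul_comm,
      sub_self]
  have hz0 : z = 0 := by
    by_contra hne
    refine dotProduct_ne_zero_of_mulVec_eq_smul (hS h hh) hk hne (μ := μ ^ h) ?_ hzk
    rw [hz, Matrix.mulVec_sub, Matrix.mulVec_smul, Matrix.mulVec_smul,
      map_pow_mulVec_of_mem_eigenspace S hv, map_pow_mulVec_of_mem_eigenspace S hw, heq, smul_sub,
      smul_comm (κ ⬝ᵥ w), smul_comm (κ ⬝ᵥ v) (ν ^ h)]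
  have h3 : (κ ⬝ᵥ w) • v = (κ ⬝ᵥ v) • w := sub_eq_zero.1 hz0
  have h4 : (κ ⬝ᵥ w) • μ • v = (κ ⬝ᵥ v) • ν • w := by
    rw [← h1, ← h2, ← Matrix.mulVec_smul, ← Matrix.mulVec_smul, h3]
  rw [smul_comm, h3, smul_comm, ← sub_eq_zero, ← smul_sub, ← sub_smul] at h4
  rcases smul_eq_zero.1 h4 with h | h
  · exact hkv h
  · rcases smul_eq_zero.1 h with h | h
    · exact hμν (sub_eq_zero.1 h)
    · exact hw0 h

/-- An irreducible integer matrix is diagonalizable over the complex numbers. -/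
theorem iSup_eigenspace_complexMap_eq_top {d : ℕ} {S : Matrix (Fin d) (Fin d) ℤ}
    (hS : IsIrreducibleMatrix S) : ⨆ μ, (complexMap S).eigenspace μ = ⊤ := by
  -- Irreducibility in characteristic zero gives separability, which survives the extension from ℚ
  -- to ℂ.
  have hsq : Squarefree (S.map (Int.castRingHom ℂ)).charpoly := by
    have h1 : (S.charpoly.map (Int.castRingHom ℚ)).Separable := Irreducible.separable hS
    have h2 := (h1.map (f := algebraMap ℚ ℂ)).squarefree
    rw [Polynomial.map_map] at h2
    rwa [Subsingleton.elim ((algebraMap ℚ ℂ).comp (Int.castRingHom ℚ)) (Int.castRingHom ℂ),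
      ← Matrix.charpoly_map] at h2
  have hss : (complexMap S).IsSemisimple := by
    refine Module.End.isSemisimple_of_squarefree_aeval_eq_zero hsq ?_
    have h1 := LinearMap.aeval_self_charpoly (complexMap S)
    rwa [complexMap, Matrix.charpoly_toLin'] at h1
  rw [← Module.End.iSup_maxGenEigenspace_eq_top (complexMap S)]
  exact iSup_congr fun μ => (hss.isFinitelySemisimple.maxGenEigenspace_eq_eigenspace μ).symm

/-- Real parts of eigenvectors lie in the real eigenspaces. -/
theorem re_mem_realEigenspace {d : ℕ} (S : Matrix (Fin d) (Fin d) ℤ) {μ : ℂ} {v : Fin d → ℂ}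
    (hv : v ∈ (complexMap S).eigenspace μ) : (fun i => (v i).re) ∈ realEigenspace S μ := by
  have hconj : (fun i => (starRingEnd ℂ) (v i)) ∈
      (complexMap S).eigenspace ((starRingEnd ℂ) μ) := by
    rw [Module.End.mem_eigenspace_iff] at hv ⊢
    ext i
    have h1 := congrArg (starRingEnd ℂ) (congrFun hv i)
    simpa [complexMap, Matrix.toLin'_apply, Matrix.mulVec, dotProduct, map_sum] using h1
  change complexify d (fun i => (v i).re) ∈ (complexMap S).eigenspace μ ⊔
    (complexMap S).eigenspace (starRingEnd ℂ μ)
  have heq : complexify d (fun i => (v i).re) =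
      (1 / 2 : ℂ) • v + (1 / 2 : ℂ) • fun i => (starRingEnd ℂ) (v i) := by
    ext i
    have h1 : complexify d (fun i => (v i).re) i = ((v i).re : ℂ) := rfl
    rw [h1, Complex.re_eq_add_conj]
    simp only [Pi.add_apply, Pi.smul_apply, smul_eq_mul]
    ring
  rw [heq]
  exact Submodule.add_mem_sup (Submodule.smul_mem _ _ hv) (Submodule.smul_mem _ _ hconj)

/-- A vector outside the weak stable subspace has a nonzero eigencomponent for an eigenvalue of
modulus greater than one. -/
theorem exists_one_lt_norm_of_notMem_weakStable {d : ℕ} (S : Matrix (Fin d) (Fin d) ℤ)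
    {w : Fin d → ℝ} (hw : w ∉ weakStable S) (f : ℂ →₀ (Fin d → ℂ))
    (hf : ∀ μ, f μ ∈ (complexMap S).eigenspace μ) (hfw : (f.sum fun _ v => v) = complexify d w) :
    ∃ μ ∈ f.support, 1 < ‖μ‖ := by
  by_contra! hle
  refine hw ?_
  -- As `w` is real, it is the sum of the real parts of its eigencomponents.
  have heq : w = ∑ μ ∈ f.support, fun i => (f μ i).re := by
    ext i
    have h1 : (complexify d w i).re = w i := rfl
    rw [← h1, ← hfw, Finsupp.sum, Finset.sum_apply, Finset.sum_apply, Complex.re_sum]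
  rw [heq]
  refine Submodule.sum_mem _ fun μ hμ => ?_
  exact Submodule.mem_iSup_of_mem μ
    (Submodule.mem_iSup_of_mem (hle μ hμ) (re_mem_realEigenspace S (hf μ)))

/-! ### Weyl's criterion and characters along toral orbits -/

instance isProbabilityMeasure_volume_unitAddCircle :
    IsProbabilityMeasure (volume : Measure UnitAddCircle) :=
  ⟨by simp⟩

/-- The integral of a character of the torus. -/
theorem integral_mFourier {d : ℕ} {k : Fin d → ℤ} (hk : k ≠ 0) :
    ∫ y, UnitAddTorus.mFourier k y = 0 := by
  rw [UnitAddTorus.mFourier, ContinuousMap.coe_mk, integral_fintype_prod_volume_eq_prod]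
  obtain ⟨i, hi⟩ := Function.ne_iff.1 hk
  -- In a coordinate with kᵢ ≠ 0, translation by half a period 1/(2kᵢ) changes the sign of the
  -- factor.
  exact Finset.prod_eq_zero (Finset.mem_univ i)
    (integral_eq_zero_of_add_right_eq_neg (fourier_add_half_inv_index hi one_pos))

/-- Weyl's criterion for a sequence of points of the torus. -/
theorem tendsto_average_of_tendsto_average_mFourier {d : ℕ} (p : ℕ → UnitAddTorus (Fin d))
    (hp : ∀ k : Fin d → ℤ, k ≠ 0 → Tendsto (fun N : ℕ => (1 / (N : ℂ)) *
      ∑ n ∈ Finset.range N, UnitAddTorus.mFourier k (p n)) atTop (𝓝 0))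
    (f : C(UnitAddTorus (Fin d), ℂ)) :
    Tendsto (fun N : ℕ => (1 / (N : ℂ)) * ∑ n ∈ Finset.range N, f (p n)) atTop
      (𝓝 (∫ y, f y)) := by
  have hint : ∀ g : C(UnitAddTorus (Fin d), ℂ), Integrable g := fun g =>
    g.continuous.integrable_of_hasCompactSupport (HasCompactSupport.of_compactSpace _)
  have hspan : ∀ g ∈ Submodule.span ℂ (Set.range (UnitAddTorus.mFourier (d := Fin d))),
      Tendsto (fun N : ℕ => (1 / (N : ℂ)) * ∑ n ∈ Finset.range N, g (p n)) atTop
        (𝓝 (∫ y, g y)) := by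
    intro g hg
    induction hg using Submodule.span_induction with
    | mem g hg =>
      obtain ⟨k, rfl⟩ := hg
      rcases eq_or_ne k 0 with rfl | hk
      · rw [UnitAddTorus.mFourier_zero]
        refine tendsto_nhds_of_eventually_eq ?_
        filter_upwards [eventually_ne_atTop 0] with N hN
        have hN' : (N : ℂ) ≠ 0 := Nat.cast_ne_zero.2 hN
        simp [hN']
      · rw [integral_mFourier hk]
        exact hp k hk
    | zero => simp
    | add g₁ g₂ _ _ h₁ h₂ =>
      simp only [ContinuousMap.add_apply]
      rw [integral_add (hint g₁) (hint g₂)]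
      refine (h₁.add h₂).congr fun N => ?_
      rw [Finset.sum_add_distrib, mul_add]
    | smul c g _ h =>
      simp only [ContinuousMap.smul_apply, smul_eq_mul]
      rw [integral_const_mul]
      refine (h.const_mul c).congr fun N => ?_
      rw [← Finset.mul_sum]
      ring
  rw [Metric.tendsto_nhds]
  intro ε hε
  -- Trigonometric polynomials are uniformly dense, and both the averages and the integral are
  -- contractions for the uniform norm.
  have hf : f ∈ closure (Submodule.span ℂ (Set.range (UnitAddTorus.mFourier (d := Fin d))) :
      Set C(UnitAddTorus (Fin d), ℂ)) := by
    rw [← Submodule.topologicalClosure_coe, UnitAddTorus.span_mFourier_closure_eq_top]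
    trivial
  obtain ⟨g, hg, hfg⟩ := Metric.mem_closure_iff.1 hf (ε / 3) (by positivity)
  have hpt : ∀ y, ‖f y - g y‖ ≤ dist f g := fun y => by
    rw [← dist_eq_norm]
    exact ContinuousMap.dist_apply_le_dist y
  filter_upwards [Metric.tendsto_nhds.1 (hspan g hg) (ε / 3) (by positivity)] with N hN
  have h1 : dist ((1 / (N : ℂ)) * ∑ n ∈ Finset.range N, f (p n))
      ((1 / (N : ℂ)) * ∑ n ∈ Finset.range N, g (p n)) ≤ dist f g := by
    rw [dist_eq_norm, ← mul_sub, ← Finset.sum_sub_distrib, norm_mul, norm_div, norm_one,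
      Complex.norm_natCast, one_div_mul_eq_div]
    refine div_le_of_le_mul₀ (by positivity) dist_nonneg ?_
    refine (norm_sum_le_of_le _ fun n _ => hpt (p n)).trans ?_
    simp [mul_comm]
  have h2 : dist (∫ y, g y) (∫ y, f y) ≤ dist f g := by
    rw [dist_comm, dist_eq_norm, ← integral_sub (hint f) (hint g)]
    refine (norm_integral_le_of_norm_le_const (Eventually.of_forall hpt)).trans ?_
    simp
  have h3 := dist_triangle4 ((1 / (N : ℂ)) * ∑ n ∈ Finset.range N, f (p n))
    ((1 / (N : ℂ)) * ∑ n ∈ Finset.range N, g (p n)) (∫ y, g y) (∫ y, f y)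
  linarith

theorem toralMap_add {d : ℕ} (S : Matrix (Fin d) (Fin d) ℤ) (x y : UnitAddTorus (Fin d)) :
    toralMap S (x + y) = toralMap S x + toralMap S y := by
  ext i
  simp [toralMap, smul_add, Finset.sum_add_distrib]

open Matrix in
theorem toralMap_torusProj {d : ℕ} (S : Matrix (Fin d) (Fin d) ℤ) (v : Fin d → ℝ) :
    toralMap S (torusProj v) = torusProj (S.map (Int.castRingHom ℝ) *ᵥ v) := by
  ext i
  change ∑ j, S i j • ((v j : ℝ) : UnitAddCircle) =
    QuotientAddGroup.mk' (AddSubgroup.zmultiples (1 : ℝ)) (∑ j, (S i j : ℝ) * v j)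
  rw [map_sum]
  refine Finset.sum_congr rfl fun j _ => ?_
  rw [← zsmul_eq_mul, map_zsmul]
  rfl

open Matrix in
theorem iterate_toralMap_add_torusProj {d : ℕ} (S : Matrix (Fin d) (Fin d) ℤ)
    (x : UnitAddTorus (Fin d)) (v : Fin d → ℝ) (n : ℕ) :
    (toralMap S)^[n] (x + torusProj v) =
      (toralMap S)^[n] x + torusProj ((S.map (Int.castRingHom ℝ)) ^ n *ᵥ v) := by
  induction n with
  | zero => simp
  | succ n ih =>
    rw [Function.iterate_succ_apply', Function.iterate_succ_apply', ih, toralMap_add,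
      toralMap_torusProj, Matrix.mulVec_mulVec, ← pow_succ']

theorem mFourier_apply_add {d : ℕ} (k : Fin d → ℤ) (x y : UnitAddTorus (Fin d)) :
    UnitAddTorus.mFourier k (x + y) = UnitAddTorus.mFourier k x * UnitAddTorus.mFourier k y := by
  simp only [UnitAddTorus.mFourier, ContinuousMap.coe_mk, Pi.add_apply, fourier_apply, smul_add,
    AddCircle.toCircle_add, Circle.coe_mul, Finset.prod_mul_distrib]

open Matrix in
theorem mFourier_torusProj {d : ℕ} (k : Fin d → ℤ) (v : Fin d → ℝ) :
    UnitAddTorus.mFourier k (torusProj v) =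
      Complex.exp (2 * Real.pi * Complex.I * (((fun i => (k i : ℝ)) ⬝ᵥ v : ℝ) : ℂ)) := by
  simp only [UnitAddTorus.mFourier, ContinuousMap.coe_mk, torusProj, fourier_coe_apply,
    ← Complex.exp_sum, dotProduct]
  congr 1
  push_cast
  rw [Finset.mul_sum]
  exact Finset.sum_congr rfl fun i _ => by ring

theorem norm_mFourier_apply {d : ℕ} (k : Fin d → ℤ) (x : UnitAddTorus (Fin d)) :
    ‖UnitAddTorus.mFourier k x‖ = 1 := by
  simp only [UnitAddTorus.mFourier, ContinuousMap.coe_mk, fourier_apply, norm_prod,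
    Circle.norm_coe, Finset.prod_const_one]

open Matrix in
/-- The orbit of a real vector paired with an integral functional, in eigencoordinates. -/
theorem ofReal_dotProduct_pow_mulVec {d : ℕ} (S : Matrix (Fin d) (Fin d) ℤ) (k : Fin d → ℤ)
    (w : Fin d → ℝ) (f : ℂ →₀ (Fin d → ℂ)) (hf : ∀ μ, f μ ∈ (complexMap S).eigenspace μ)
    (hfw : (f.sum fun _ v => v) = complexify d w) (n : ℕ) :
    (((fun i => (k i : ℝ)) ⬝ᵥ (S.map (Int.castRingHom ℝ)) ^ n *ᵥ w : ℝ) : ℂ) =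
      ∑ μ ∈ f.support, ((fun i => (k i : ℂ)) ⬝ᵥ f μ) * μ ^ n := by
  have h1 : (((fun i => (k i : ℝ)) ⬝ᵥ (S.map (Int.castRingHom ℝ)) ^ n *ᵥ w : ℝ) : ℂ) =
      (fun i => (k i : ℂ)) ⬝ᵥ (S ^ n).map (Int.castRingHom ℂ) *ᵥ complexify d w := by
    rw [← Matrix.map_pow]
    simp [dotProduct, Matrix.mulVec, complexify]
  rw [h1, ← hfw, Finsupp.sum, Matrix.mulVec_sum, dotProduct_sum]
  refine Finset.sum_congr rfl fun μ _ => ?_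
  rw [map_pow_mulVec_of_mem_eigenspace S (hf μ), dotProduct_smul, smul_eq_mul, mul_comm]

/-! ### Almost every point on the line equidistributes -/

open Matrix in
theorem theorem4p5 (d : ℕ) (S : GL (Fin d) ℤ)
    (hS : IsTotallyIrreducible (S : Matrix (Fin d) (Fin d) ℤ))
    (W : Submodule ℝ (Fin d → ℝ)) (hW : Module.finrank ℝ W = 1)
    (hWS : ¬ W ≤ weakStable (S : Matrix (Fin d) (Fin d) ℤ))
    (w : Fin d → ℝ) (hw : w ∈ W) (hw0 : w ≠ 0) (x : UnitAddTorus (Fin d)) :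
    ∀ᵐ φ : ℝ ∂(volume.restrict (Set.Icc (-(1 / 2) : ℝ) (1 / 2))),
      x + torusProj (φ • w) ∈ equidistributedPoints (S : Matrix (Fin d) (Fin d) ℤ) := by
  classical
  generalize (S : Matrix (Fin d) (Fin d) ℤ) = S at hS hWS ⊢
  have hwS : w ∉ weakStable S := fun h => hWS fun v hv => by
    obtain ⟨c, hc⟩ := exists_smul_eq_of_finrank_eq_one hW
      (x := (⟨w, hw⟩ : W)) (fun h0 => hw0 (congrArg Subtype.val h0)) ⟨v, hv⟩
    have h1 : c • w = v := congrArg Subtype.val hc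
    rw [← h1]
    exact Submodule.smul_mem _ c h
  have hS1 : IsIrreducibleMatrix S := by simpa using hS 1 le_rfl
  have htop : complexify d w ∈ ⨆ μ, (complexMap S).eigenspace μ := by
    rw [iSup_eigenspace_complexMap_eq_top hS1]
    trivial
  obtain ⟨f, hf, hfw⟩ := (Submodule.mem_iSup_iff_exists_finsupp _ _).1 htop
  obtain ⟨μ₀, hμ₀, hμ₀1⟩ := exists_one_lt_norm_of_notMem_weakStable S hwS f hf hfw
  -- The maximum need not be unique: when `l` is not real, its conjugate has the same modulus.
  obtain ⟨l, hl, hmax⟩ := f.support.exists_max_image (fun μ => ‖μ‖) ⟨μ₀, hμ₀⟩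
  have hl1 : 1 < ‖l‖ := hμ₀1.trans_le (hmax μ₀ hμ₀)
  have hl0 : f l ≠ 0 := Finsupp.mem_support_iff.1 hl
  have hchar : ∀ k : Fin d → ℤ, ∀ᵐ φ : ℝ ∂(volume.restrict (Set.Icc (-(1 / 2) : ℝ) (1 / 2))),
      k ≠ 0 → Tendsto (fun N : ℕ => (1 / (N : ℂ)) * ∑ n ∈ Finset.range N,
        UnitAddTorus.mFourier k ((toralMap S)^[n] (x + torusProj (φ • w)))) atTop (𝓝 0) := by
    intro k
    by_cases hk : k = 0
    · simp [hk]
    have hc : (fun i => (k i : ℂ)) ⬝ᵥ f l ≠ 0 :=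
      dotProduct_ne_zero_of_mulVec_eq_smul hS1 hk hl0 (Module.End.mem_eigenspace_iff.1 (hf l))
    have hae := ae_tendsto_average_exponential_sum hl1 (f.support.erase l)
      (fun μ hμ => ⟨hmax μ (Finset.mem_of_mem_erase hμ), fun h hh =>
        pow_ne_pow_of_isTotallyIrreducible hS (Finset.ne_of_mem_erase hμ) (hf μ)
          (Finsupp.mem_support_iff.1 (Finset.mem_of_mem_erase hμ)) (hf l) hl0 hh⟩)
      ((fun i => (k i : ℂ)) ⬝ᵥ f l) (fun μ => (fun i => (k i : ℂ)) ⬝ᵥ f μ) hc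
      (fun n => (fun i => (k i : ℝ)) ⬝ᵥ (S.map (Int.castRingHom ℝ)) ^ n *ᵥ w)
      (fun n => by
        rw [ofReal_dotProduct_pow_mulVec S k w f hf hfw]
        exact (Finset.add_sum_erase _ (fun μ => ((fun i => (k i : ℂ)) ⬝ᵥ f μ) * μ ^ n) hl).symm)
      -- The base point enters only through these unimodular coefficients, which do not depend on φ.
      (fun n => UnitAddTorus.mFourier k ((toralMap S)^[n] x))
      (fun n => norm_mFourier_apply k _)
    filter_upwards [hae] with φ hφ _
    refine hφ.congr fun N => ?_
    congr 1
    refine Finset.sum_congr rfl fun n _ => ?_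
    rw [iterate_toralMap_add_torusProj, mFourier_apply_add, mFourier_torusProj, Matrix.mulVec_smul,
      dotProduct_smul, smul_eq_mul]
    push_cast
    rfl
  filter_upwards [ae_all_iff.2 hchar] with φ hφ
  exact fun g => tendsto_average_of_tendsto_average_mFourier _ hφ g
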